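/- Let $\mathcal A$ be a (complex, not necessarily unital) C*-algebra, and let $PS(\mathcal A)$ be the set of pure states of $\mathcal A$ with the weak* topology; a pure state is a positive linear functional $\varphi$ of norm one such that every positive functional $\psi\le\varphi$ is of the form $t\varphi$ with $0\le t\le 1$. For a topological space $T$ let $T^{(0)}=T$, let $T^{(\alpha+1)}$ be the set of cluster points of $T^{(\alpha)}$, and let $T^{(\alpha)}=\bigcap_{\beta<\alpha}T^{(\beta)}$ for limit ordinals $\alpha$; let $i(T)$ be the least ordinal $\alpha$ with $T^{(\alpha)}=\emptyset$, and $i(T)=\infty$ if there is none. The space $T$ is scattered if each of its nonempty subsets has a relatively isolated point. A projection $p$ in a C*-algebra $\mathcal B$ is minimal if $p\mathcal Bp=\mathbb Cp$, and $\mathcal A$ is called scattered if every nonzero quotient of $\mathcal A$ by a closed two-sided ideal has a nonzero minimal projection. Theorem. $i(PS(\mathcal A))<\infty$ if and only if $\mathcal A$ is commutative and scattered. Equivalently, the topological space $PS(\mathcal A)$ is scattered if and only if $\mathcal A$ is commutative and scattered. -/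

import Mathlib

open scoped Topology ComplexOrder CantorBendixson

universe u

section Topological

/-- A topological space is scattered if each of its nonempty subsets has a relatively isolated
point. -/
def IsScatteredSpace (T : Type u) [TopologicalSpace T] : Prop :=
  ∀ S : Set T, S.Nonempty → ∃ x ∈ S, ∃ U : Set T, IsOpen U ∧ U ∩ S = {x}

/-- The Cantor-Bendixson index `i(T)`: the least ordinal `α` with `T^(α) = ∅`, and `⊤` (that is,
`∞`) if there is no such ordinal. Here `T^(α)` is the `α`-th iterated derived set of the whole
space. -/
noncomputable def cantorBendixsonIndex (T : Type u) [TopologicalSpace T] : WithTop Ordinal.{u} :=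
  sInf ((fun α : Ordinal.{u} => (α : WithTop Ordinal.{u})) ''
    {α : Ordinal.{u} | (Set.univ : Set T)ᵈ[α] = ∅})

end Topological

namespace CStar

section States

variable {A : Type u} [NonUnitalCStarAlgebra A]

/-- A continuous linear functional is positive if it is nonnegative on all elements `a* a`. -/
def IsPositiveFunctional (φ : WeakDual ℂ A) : Prop :=
  ∀ a : A, 0 ≤ φ (star a * a)

/-- A state is a positive linear functional of norm one. -/
def IsState (φ : WeakDual ℂ A) : Prop :=
  IsPositiveFunctional φ ∧ ‖WeakDual.toStrongDual φ‖ = 1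

/-- A state `φ` is pure if every positive functional dominated by `φ` has the form `t φ` with
`0 ≤ t ≤ 1`. -/
def IsPureState (φ : WeakDual ℂ A) : Prop :=
  IsState φ ∧ ∀ ψ : WeakDual ℂ A, IsPositiveFunctional ψ →
    (∀ a : A, ψ (star a * a) ≤ φ (star a * a)) →
      ∃ t : ℝ, 0 ≤ t ∧ t ≤ 1 ∧ ψ = (t : ℂ) • φ

variable (A) in
/-- The set of pure states of `A`. As a type it carries the topology induced by the weak*
topology of the dual of `A`. -/
def pureStates : Set (WeakDual ℂ A) :=
  {φ | IsPureState φ}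

end States

section Quotients

/-- A norm-closed two-sided ideal of a C*-algebra. -/
structure ClosedIdeal (A : Type u) [NonUnitalCStarAlgebra A] extends Submodule ℂ A where
  mul_mem_left' : ∀ (a : A) {x : A}, x ∈ carrier → a * x ∈ carrier
  mul_mem_right' : ∀ {x : A} (a : A), x ∈ carrier → x * a ∈ carrier
  isClosed' : IsClosed carrier

namespace ClosedIdeal

variable {A : Type u} [NonUnitalCStarAlgebra A] (I : ClosedIdeal A)

/-- A closed two-sided ideal of a C*-algebra is self-adjoint. -/
theorem star_mem {x : A} (hx : x ∈ I.toSubmodule) : star x ∈ I.toSubmodule := by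
  have hcl : IsClosed (I.toSubmodule : Set A) := I.isClosed'
  let _ : PartialOrder A := CStarAlgebra.spectralOrder A
  have _ : StarOrderedRing A := CStarAlgebra.spectralOrderedRing A
  set h : A := x * star x with hh
  have hh0 : 0 ≤ h := mul_star_self_nonneg x
  have hsa : IsSelfAdjoint h := hh0.isSelfAdjoint
  let g : ℕ → ℝ → ℝ := fun n t => n ^ 2 * t / (1 + n ^ 2 * t ^ 2)
  have hg : ∀ n, Continuous (g n) := fun n => by
    refine Continuous.div (by fun_prop) (by fun_prop) fun t => by positivity
  have hg0 : ∀ n, g n 0 = 0 := fun n => by simp [g]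
  let k : ℕ → A := fun n => cfcₙ (g n) h
  let e : ℕ → A := fun n => h * k n
  have hhI : h ∈ I.toSubmodule := I.mul_mem_right' (star x) hx
  have heI : ∀ n, star x * e n ∈ I.toSubmodule := fun n =>
    I.mul_mem_left' _ (I.mul_mem_right' _ hhI)
  have he : ∀ n, e n = cfcₙ (fun t : ℝ => t * g n t) h := fun n => by
    rw [cfcₙ_mul (fun t : ℝ => t) (g n) h (by fun_prop) rfl (hg n).continuousOn (hg0 n),
      cfcₙ_id' ℝ h]
  have hesa : ∀ n, IsSelfAdjoint (e n) := fun n => by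
    rw [he]; exact cfcₙ_predicate _ h
  have hbound : ∀ n : ℕ, 0 < n → ‖star x - star x * e n‖ ^ 2 ≤ 1 / (n : ℝ) := fun n hn => by
    have h1 : star (star x - star x * e n) * (star x - star x * e n)
        = h - h * e n - e n * h + e n * h * e n := by
      simp only [star_sub, star_mul, star_star, (hesa n).star_eq, hh]
      noncomm_ring
    have h2 : h - h * e n - e n * h + e n * h * e n
        = cfcₙ (fun t : ℝ => t - t * (t * g n t) - (t * g n t) * t
            + (t * g n t) * t * (t * g n t)) h := by
      have c := hg n
      have z := hg0 n
      rw [cfcₙ_add (a := h) (fun t : ℝ => t - t * (t * g n t) - (t * g n t) * t)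
          (fun t : ℝ => (t * g n t) * t * (t * g n t)) (by fun_prop) (by simp) (by fun_prop)
          (by simp),
        cfcₙ_sub (a := h) (fun t : ℝ => t - t * (t * g n t)) (fun t : ℝ => (t * g n t) * t)
          (by fun_prop) (by simp) (by fun_prop) (by simp),
        cfcₙ_sub (a := h) (fun t : ℝ => t) (fun t : ℝ => t * (t * g n t))
          (by fun_prop) (by simp) (by fun_prop) (by simp),
        cfcₙ_mul (fun t : ℝ => (t * g n t) * t) (fun t : ℝ => t * g n t) h
          (by fun_prop) (by simp) (by fun_prop) (by simp),
        cfcₙ_mul (fun t : ℝ => (t * g n t)) (fun t : ℝ => t) h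
          (by fun_prop) (by simp) (by fun_prop) (by simp),
        cfcₙ_mul (fun t : ℝ => t) (fun t : ℝ => t * g n t) h
          (by fun_prop) (by simp) (by fun_prop) (by simp), cfcₙ_id' ℝ h, ← he n]
    rw [pow_two, ← CStarRing.norm_star_mul_self, h1, h2]
    refine norm_cfcₙ_le_iff _ h _ |>.2 fun t ht => ?_
    have ht0 : 0 ≤ t := quasispectrum_nonneg_of_nonneg h hh0 t ht
    have hn' : (0 : ℝ) < n := by exact_mod_cast hn
    have hD : (0 : ℝ) < 1 + n ^ 2 * t ^ 2 := by positivity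
    have h3 : t - t * (t * g n t) - (t * g n t) * t + (t * g n t) * t * (t * g n t)
        = t / (1 + n ^ 2 * t ^ 2) ^ 2 := by
      simp only [g]; field_simp; ring
    rw [h3, Real.norm_of_nonneg (by positivity), div_le_div_iff₀ (by positivity) hn']
    nlinarith [sq_nonneg ((n : ℝ) * t - 1), sq_nonneg ((n : ℝ) ^ 2 * t ^ 2)]
  have hlim : Filter.Tendsto (fun n => star x * e n) Filter.atTop (𝓝 (star x)) := by
    rw [tendsto_iff_norm_sub_tendsto_zero]
    have hsq : Filter.Tendsto (fun n => ‖star x * e n - star x‖ ^ 2) Filter.atTop (𝓝 0) := by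
      refine squeeze_zero' (Filter.Eventually.of_forall fun n => by positivity) ?_
        tendsto_one_div_atTop_nhds_zero_nat
      filter_upwards [Filter.eventually_gt_atTop 0] with n hn
      rw [norm_sub_rev]; exact hbound n hn
    have := hsq.sqrt
    simpa [Real.sqrt_sq] using this
  exact hcl.mem_of_tendsto hlim (Filter.Eventually.of_forall heI)

/-- The quotient `A / I`, with its quotient vector space structure. -/
abbrev Quot : Type u := A ⧸ I.toSubmodule

/-- The product of `A / I`: `(a + I) (b + I) = a b + I`. -/
instance : Mul I.Quot where
  mul := Quotient.map₂ (fun a b : A => a * b) fun a a' ha b b' hb => by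
    replace ha := (Submodule.quotientRel_def _).1 ha
    replace hb := (Submodule.quotientRel_def _).1 hb
    refine (Submodule.quotientRel_def _).2 ?_
    have h := I.toSubmodule.add_mem (I.mul_mem_right' b ha) (I.mul_mem_left' a' hb)
    have e : a * b - a' * b' = (a - a') * b + a' * (b - b') := by noncomm_ring
    rw [e]; exact h

/-- The involution of `A / I`: `(a + I)* = a* + I`. -/
instance : Star I.Quot where
  star := Quotient.map (fun a : A => star a) fun a a' ha => by
    replace ha := (Submodule.quotientRel_def _).1 ha
    refine (Submodule.quotientRel_def _).2 ?_
    rw [← star_sub]; exact I.star_mem ha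

theorem mk_mul (a b : A) : (I.toSubmodule.mkQ (a * b) : I.Quot)
    = (I.toSubmodule.mkQ a : I.Quot) * (I.toSubmodule.mkQ b : I.Quot) := rfl

theorem mk_star (a : A) : (I.toSubmodule.mkQ (star a) : I.Quot)
    = star (I.toSubmodule.mkQ a : I.Quot) := rfl

end ClosedIdeal

end Quotients

/-- A minimal projection of a *-algebra `B`: a projection `p` with `p B p = ℂ p`. -/
def IsMinimalProjection {B : Type u} [Mul B] [Star B] [SMul ℂ B] (p : B) : Prop :=
  IsStarProjection p ∧ Set.range (fun b : B => p * b * p) = Set.range (fun c : ℂ => c • p)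

/-- A C*-algebra `A` is scattered if every nonzero quotient `A / I` by a closed two-sided ideal
has a nonzero minimal projection. -/
def IsScatteredAlgebra (A : Type u) [NonUnitalCStarAlgebra A] : Prop :=
  ∀ I : ClosedIdeal A, Nontrivial I.Quot → ∃ p : I.Quot, p ≠ 0 ∧ IsMinimalProjection p

end CStar

/-!
A space is scattered exactly when its Cantor-Bendixson derivatives reach the empty set
(`cantorBendixsonIndex_lt_top_iff`), so everything is about scatteredness of the pure state space.

*Scattered pure states force commutativity.* Let `φ` be a pure state and consider its orbit
`φ (u* · u)` under the unitaries `u` of the unitization, which consists of pure states. An isolated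
point `ψ` of this orbit is fixed by `exp (i s h)` for selfadjoint `h` and all small real `s`;
differentiating at `s = 0` gives `ψ (x h) = ψ (h x)`, so `ψ`, and with it `φ`, is a trace
(`IsPureState.apply_mul_comm_of_isScatteredSpace`). A pure state that is a trace is proportional to
a character, since `x ↦ φ (a* a x)` is then a positive functional dominated by a multiple of `φ`
(`IsPureState.exists_apply_mul_eq`). Therefore all pure states vanish at `z* z` for each commutator
`z`, and since pure states detect nonzero positive elements (`exists_isPureState_apply_ne_zero`),
`z = 0`. The existence of pure states is the Krein-Milman theorem for the weak* compact convex set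
of positive functionals of norm at most one; its nonzero extreme points are pure because the norm
is additive on positive functionals (`IsPositiveFunctional.norm_add`).

*Scattered pure states and commutativity force a scattered algebra.* By Gelfand duality for the
unitization, a closed ideal `I` is determined by the characters vanishing on it, its hull. An
isolated point of the hull is cut out by a Urysohn function, which is the Gelfand transform of an
element whose class modulo `I` is a minimal projection (`isScatteredAlgebra_of_isScatteredSpace`).

*Commutative scattered algebras have scattered pure states.* For a nonempty set `S` of pure states,
a minimal projection of the quotient by the ideal of common zeros of `S` is nonzero at exactly one
point of `S` (`isScatteredSpace_of_isScatteredAlgebra`).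
-/

namespace CStar

/-! ### Positive functionals -/

section PositiveFunctionals

variable {A : Type u} [NonUnitalCStarAlgebra A]

open Filter

section Order

variable [PartialOrder A] [StarOrderedRing A]

theorem IsPositiveFunctional.apply_nonneg {φ : WeakDual ℂ A} (hφ : IsPositiveFunctional φ)
    {a : A} (ha : 0 ≤ a) : 0 ≤ φ a := by
  obtain ⟨b, rfl⟩ := CStarAlgebra.nonneg_iff_eq_star_mul_self.1 ha
  exact hφ b

/-- A positive continuous functional as a `PositiveLinearMap`, which gives access to the
Gelfand-Naimark-Segal inner product `⟪a, b⟫ = φ (a* b)`. -/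
noncomputable def IsPositiveFunctional.toPositiveLinearMap {φ : WeakDual ℂ A} (hφ : IsPositiveFunctional φ) :
    A →ₚ[ℂ] ℂ :=
  PositiveLinearMap.mk₀ (WeakDual.toStrongDual φ).toLinearMap fun _ ha => hφ.apply_nonneg ha

end Order

theorem IsPositiveFunctional.smul {φ : WeakDual ℂ A} (hφ : IsPositiveFunctional φ)
    {t : ℝ} (ht : 0 ≤ t) : IsPositiveFunctional ((t : ℂ) • φ) := fun a =>
  mul_nonneg (by exact_mod_cast ht) (hφ a)

theorem norm_apply_le (φ : WeakDual ℂ A) (x : A) :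
    ‖φ x‖ ≤ ‖WeakDual.toStrongDual φ‖ * ‖x‖ :=
  (WeakDual.toStrongDual φ).le_opNorm x

/-- The Cauchy-Schwarz inequality for the sesquilinear form `φ (a* b)`. -/
theorem IsPositiveFunctional.norm_apply_star_mul_sq_le {φ : WeakDual ℂ A}
    (hφ : IsPositiveFunctional φ) (a b : A) :
    ‖φ (star a * b)‖ ^ 2 ≤ (φ (star a * a)).re * (φ (star b * b)).re := by
  let _ : PartialOrder A := CStarAlgebra.spectralOrder A
  have _ : StarOrderedRing A := CStarAlgebra.spectralOrderedRing A
  let f := hφ.toPositiveLinearMap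
  have h := norm_inner_le_norm (𝕜 := ℂ) (f.toPreGNS a) (f.toPreGNS b)
  have h2 : ∀ c : A, ‖f.toPreGNS c‖ ^ 2 = (φ (star c * c)).re := fun c => by
    rw [PositiveLinearMap.preGNS_norm_def, Real.sq_sqrt]
    · rfl
    · exact (Complex.nonneg_iff.1 (hφ c)).1
  rw [← h2, ← h2, ← mul_pow]
  exact pow_le_pow_left₀ (norm_nonneg _) h 2

theorem re_apply_star_mul_self_le {φ : WeakDual ℂ A} (a : A) :
    (φ (star a * a)).re ≤ ‖WeakDual.toStrongDual φ‖ * ‖a‖ ^ 2 := by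
  refine (Complex.re_le_norm _).trans ((norm_apply_le φ _).trans_eq ?_)
  rw [CStarRing.norm_star_mul_self, sq]

/-- The functional form of `star a * star b * b * a ≤ ‖b‖ ^ 2 • (star a * a)`. -/
theorem IsPositiveFunctional.apply_star_mul_self_mul_le {φ : WeakDual ℂ A}
    (hφ : IsPositiveFunctional φ) (a b : A) :
    φ (star (b * a) * (b * a)) ≤ ((‖b‖ ^ 2 : ℝ) : ℂ) * φ (star a * a) := by
  let _ : PartialOrder A := CStarAlgebra.spectralOrder A
  have _ : StarOrderedRing A := CStarAlgebra.spectralOrderedRing A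
  have h : star a * (star b * b) * a ≤ ‖star b * b‖ • (star a * a) :=
    CStarAlgebra.star_left_conjugate_le_norm_smul
  have h1 := hφ.apply_nonneg (sub_nonneg.2 h)
  rw [map_sub, sub_nonneg, ← Complex.coe_smul, map_smul, CStarRing.norm_star_mul_self] at h1
  rw [star_mul, mul_assoc, ← mul_assoc (star b), ← mul_assoc, sq]
  exact h1

/-- A positive functional satisfies `|φ(x)|² ≤ ‖φ‖ φ(x* x)`: apply the Cauchy-Schwarz inequality
to `φ (e x)` and let `e` run through an approximate unit. -/
theorem IsPositiveFunctional.norm_apply_sq_le {φ : WeakDual ℂ A}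
    (hφ : IsPositiveFunctional φ) (x : A) :
    ‖φ x‖ ^ 2 ≤ ‖WeakDual.toStrongDual φ‖ * (φ (star x * x)).re := by
  let _ : PartialOrder A := CStarAlgebra.spectralOrder A
  have _ : StarOrderedRing A := CStarAlgebra.spectralOrderedRing A
  have hu := CStarAlgebra.increasingApproximateUnit A
  have hc : Continuous φ := (WeakDual.toStrongDual φ).continuous
  have ht : Tendsto (fun e => ‖φ (e * x)‖ ^ 2) (CStarAlgebra.approximateUnit A)
      (𝓝 (‖φ x‖ ^ 2)) :=
    (((hc.tendsto _).comp (hu.tendsto_mul_right x)).norm.pow 2)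
  refine le_of_tendsto ht ?_
  filter_upwards [hu.eventually_norm, hu.eventually_star_eq] with e he hs
  have h := hφ.norm_apply_star_mul_sq_le e x
  rw [hs] at h
  refine h.trans (mul_le_mul_of_nonneg_right ?_ (Complex.nonneg_iff.1 (hφ x)).1)
  have h3 := re_apply_star_mul_self_le (φ := φ) e
  rw [hs] at h3
  refine h3.trans (mul_le_of_le_one_right (norm_nonneg _) ?_)
  exact pow_le_one₀ (norm_nonneg _) he

/-- Along an approximate unit `e`, a positive functional at `e* e` eventually exceeds every number
below its norm, by the Cauchy-Schwarz inequality for `φ (e x)` with `‖φ x‖` close to `‖φ‖`. -/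
theorem IsPositiveFunctional.eventually_lt_re_apply [PartialOrder A] [StarOrderedRing A]
    {φ : WeakDual ℂ A} (hφ : IsPositiveFunctional φ) {c : ℝ}
    (hc : c < ‖WeakDual.toStrongDual φ‖) :
    ∀ᶠ e in CStarAlgebra.approximateUnit A, c < (φ (star e * e)).re := by
  have hu := CStarAlgebra.increasingApproximateUnit A
  rcases lt_or_ge c 0 with h0 | h0
  · exact .of_forall fun e => h0.trans_le (Complex.nonneg_iff.1 (hφ e)).1
  set N := ‖WeakDual.toStrongDual φ‖ with hN
  have hNpos : 0 < N := h0.trans_lt hc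
  have hsq : √(c * N) < N := by
    rw [Real.sqrt_lt' hNpos, sq]; exact mul_lt_mul_of_pos_right hc hNpos
  obtain ⟨x, hx1, hx⟩ := (WeakDual.toStrongDual φ).exists_lt_apply_of_lt_opNorm hsq
  have hφc : Continuous φ := (WeakDual.toStrongDual φ).continuous
  have ht : Tendsto (fun e => ‖φ (e * x)‖) (CStarAlgebra.approximateUnit A) (𝓝 ‖φ x‖) :=
    ((hφc.tendsto _).comp (hu.tendsto_mul_right x)).norm
  filter_upwards [ht.eventually_const_lt hx, hu.eventually_star_eq] with e he hs
  have h := hφ.norm_apply_star_mul_sq_le e x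
  have h1 : c * N < ‖φ (star e * x)‖ ^ 2 := by
    rw [hs]; exact Real.lt_sq_of_sqrt_lt he
  have h2 : (φ (star x * x)).re ≤ N := by
    refine (re_apply_star_mul_self_le x).trans
      (mul_le_of_le_one_right (norm_nonneg _) (pow_le_one₀ (norm_nonneg _) hx1.le))
  have h3 := (h1.trans_le h).trans_le
    (mul_le_mul_of_nonneg_left h2 (Complex.nonneg_iff.1 (hφ e)).1)
  exact lt_of_mul_lt_mul_right h3 hNpos.le

/-- The norm is additive on positive functionals, because the norm of each is its limit along an
approximate unit. -/
theorem IsPositiveFunctional.norm_add {φ ψ : WeakDual ℂ A}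
    (hφ : IsPositiveFunctional φ) (hψ : IsPositiveFunctional ψ) :
    ‖WeakDual.toStrongDual (φ + ψ)‖
      = ‖WeakDual.toStrongDual φ‖ + ‖WeakDual.toStrongDual ψ‖ := by
  let _ : PartialOrder A := CStarAlgebra.spectralOrder A
  have _ : StarOrderedRing A := CStarAlgebra.spectralOrderedRing A
  have hu := CStarAlgebra.increasingApproximateUnit A
  refine le_antisymm (by rw [map_add]; exact norm_add_le _ _) ?_
  refine le_of_forall_pos_le_add fun ε hε => ?_
  obtain ⟨e, h1, h2, h3⟩ := ((hφ.eventually_lt_re_apply (sub_lt_self _ (half_pos hε))).and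
    ((hψ.eventually_lt_re_apply (sub_lt_self _ (half_pos hε))).and hu.eventually_norm)).exists
  have h4 : (φ (star e * e)).re + (ψ (star e * e)).re ≤ ‖WeakDual.toStrongDual (φ + ψ)‖ := by
    refine (re_apply_star_mul_self_le (φ := φ + ψ) e).trans
      (mul_le_of_le_one_right (norm_nonneg _) (pow_le_one₀ (norm_nonneg _) h3))
  linarith

end PositiveFunctionals

/-! ### Separation by positive functionals -/

section Existence

variable {A : Type u} [NonUnitalCStarAlgebra A]

/-- Positive functionals detect nonzero positive elements: separate `-h` from the closed cone of
the elements with nonnegative real part. A functional that is nonnegative on this cone is real on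
selfadjoint elements, because the cone contains `I • a` for every selfadjoint `a`. -/
theorem exists_isPositiveFunctional_apply_ne_zero [PartialOrder A] [StarOrderedRing A]
    {h : A} (h0 : 0 ≤ h) (hne : h ≠ 0) :
    ∃ φ : WeakDual ℂ A, IsPositiveFunctional φ ∧ φ h ≠ 0 := by
  let C : Set A := {a | 0 ≤ a + star a}
  have hconv : Convex ℝ C := by
    intro a ha b hb s t hs ht _
    have e : s • a + t • b + star (s • a + t • b) = s • (a + star a) + t • (b + star b) := by
      simp only [star_add, star_smul, star_trivial, smul_add]; abel
    change 0 ≤ _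
    rw [e]
    exact add_nonneg (smul_nonneg hs ha) (smul_nonneg ht hb)
  have hcl : IsClosed C :=
    CStarAlgebra.isClosed_nonneg.preimage (f := fun a : A => a + star a) (by fun_prop)
  have hnot : -h ∉ C := fun hm => by
    change 0 ≤ -h + star (-h) at hm
    rw [star_neg, h0.isSelfAdjoint.star_eq, ← neg_add, Left.nonneg_neg_iff] at hm
    exact hne (le_antisymm ((le_add_of_nonneg_right h0).trans hm) h0)
  obtain ⟨f, u, hu1, hu2⟩ := RCLike.geometric_hahn_banach_point_closed (𝕜 := ℂ) hconv hcl hnot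
  have hu0 : u < 0 := by simpa using hu2 0 (by simp [C])
  have hpos : ∀ a ∈ C, 0 ≤ (f a).re := fun a ha => by
    by_contra hlt
    push Not at hlt
    -- This positive multiple of `a` is chosen so that `re f` takes the value `u` there.
    have hmem : (u / (f a).re) • a ∈ C := by
      change 0 ≤ _
      rw [star_smul, star_trivial, ← smul_add]
      exact smul_nonneg (div_nonneg_of_nonpos hu0.le hlt.le) ha
    have := hu2 _ hmem
    rw [← Complex.coe_smul, map_smul] at this
    simp only [smul_eq_mul, RCLike.re_eq_complex_re, Complex.re_ofReal_mul] at this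
    rw [div_mul_cancel₀ _ hlt.ne] at this
    exact lt_irrefl _ this
  refine ⟨StrongDual.toWeakDual f, fun a => ?_, fun h1 => ?_⟩
  · have hs : IsSelfAdjoint (star a * a) := .star_mul_self a
    have ha : star a * a ∈ C := by
      change 0 ≤ _
      rw [hs.star_eq]
      exact add_nonneg (star_mul_self_nonneg a) (star_mul_self_nonneg a)
    have hI : ∀ c : ℂ, star c = -c → c • (star a * a) ∈ C := fun c hc => by
      change 0 ≤ _
      rw [star_smul, hs.star_eq, hc, neg_smul, add_neg_cancel]
    have i1 := hpos _ (hI Complex.I (by simp))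
    have i2 := hpos _ (hI (-Complex.I) (by simp))
    rw [map_smul] at i1 i2
    simp only [smul_eq_mul, neg_mul, Complex.neg_re, Complex.I_mul_re, neg_neg] at i1 i2
    exact Complex.nonneg_iff.2 ⟨hpos _ ha, le_antisymm i2 (neg_nonneg.1 i1)⟩
  · have h1 : f h = 0 := h1
    rw [map_neg, h1] at hu1
    simp only [neg_zero, map_zero] at hu1
    exact lt_asymm hu0 hu1

/-- The weak* topology is the weak topology of the canonical pairing, hence locally convex. -/
instance : LocallyConvexSpace ℝ (WeakDual ℂ A) :=
  inferInstanceAs (LocallyConvexSpace ℝ (WeakBilin (topDualPairing ℂ A)))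

end Existence

/-! ### Existence of pure states -/

section ExistencePure

variable {A : Type u} [NonUnitalCStarAlgebra A]

variable (A) in
/-- The positive functionals of norm at most one. -/
def quasiStates : Set (WeakDual ℂ A) :=
  {φ | IsPositiveFunctional φ ∧ ‖WeakDual.toStrongDual φ‖ ≤ 1}

theorem isCompact_quasiStates : IsCompact (quasiStates A) := by
  have h := WeakDual.isCompact_closedBall (𝕜 := ℂ) (E := A) 0 1
  have hc : IsClosed {φ : WeakDual ℂ A | IsPositiveFunctional φ} := by
    simp only [IsPositiveFunctional, Set.ofPred_forall]
    exact isClosed_iInter fun a => isClosed_Ici.preimage (WeakDual.eval_continuous (star a * a))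
  convert h.inter_left hc using 1
  ext φ
  simp [quasiStates]

theorem inv_norm_smul_mem_quasiStates {φ : WeakDual ℂ A} (hφ : IsPositiveFunctional φ) :
    ((‖WeakDual.toStrongDual φ‖⁻¹ : ℝ) : ℂ) • φ ∈ quasiStates A := by
  refine ⟨hφ.smul (by positivity), ?_⟩
  rw [map_smul, norm_smul, Complex.norm_real, norm_inv, norm_norm]
  exact inv_mul_le_one

/-- A nonzero extreme point of the set of positive functionals of norm at most one is a pure
state. A functional `ψ` dominated by `φ` writes `φ` as a convex combination of the normalizations
of `ψ` and `φ - ψ`, since the norm is additive on positive functionals. -/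
theorem isPureState_of_mem_extremePoints {φ : WeakDual ℂ A}
    (hφ : φ ∈ (quasiStates A).extremePoints ℝ) (hne : φ ≠ 0) : IsPureState φ := by
  obtain ⟨⟨hpos, hle⟩, hext⟩ := mem_extremePoints.1 hφ
  have hN : ∀ ψ : WeakDual ℂ A, ψ ≠ 0 → 0 < ‖WeakDual.toStrongDual ψ‖ := fun ψ h =>
    norm_pos_iff.2 ((map_ne_zero_iff _ WeakDual.toStrongDual.injective).2 h)
  have hinv : ∀ ψ : WeakDual ℂ A, ψ ≠ 0 → ‖WeakDual.toStrongDual ψ‖ •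
      (((‖WeakDual.toStrongDual ψ‖⁻¹ : ℝ) : ℂ) • ψ) = ψ := fun ψ h => by
    refine DFunLike.ext _ _ fun x => ?_
    change ‖WeakDual.toStrongDual ψ‖ • (((‖WeakDual.toStrongDual ψ‖⁻¹ : ℝ) : ℂ) * ψ x) = ψ x
    rw [Complex.real_smul, ← mul_assoc, ← Complex.ofReal_mul, mul_inv_cancel₀ (hN ψ h).ne',
      Complex.ofReal_one, one_mul]
  have hnorm : ‖WeakDual.toStrongDual φ‖ = 1 := by
    by_contra h1
    have h0 : (0 : WeakDual ℂ A) ∈ quasiStates A :=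
      ⟨fun a => le_rfl, by rw [map_zero, norm_zero]; exact zero_le_one⟩
    have := (hext _ (inv_norm_smul_mem_quasiStates hpos) 0 h0
      ⟨‖WeakDual.toStrongDual φ‖, 1 - ‖WeakDual.toStrongDual φ‖, hN φ hne,
        sub_pos.2 (lt_of_le_of_ne hle h1), by ring, by rw [hinv φ hne, smul_zero, add_zero]⟩).2
    exact hne this.symm
  refine ⟨⟨hpos, hnorm⟩, fun ψ hψ hψφ => ?_⟩
  have hχ : IsPositiveFunctional (φ - ψ) := fun a => sub_nonneg.2 (hψφ a)
  have hadd := hψ.norm_add hχ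
  rw [add_sub_cancel, hnorm] at hadd
  refine ⟨‖WeakDual.toStrongDual ψ‖, norm_nonneg _,
    by linarith [norm_nonneg (WeakDual.toStrongDual (φ - ψ))], ?_⟩
  by_cases hψ0 : ψ = 0
  · simp [hψ0]
  by_cases hχ0 : φ - ψ = 0
  · rw [← sub_eq_zero.1 hχ0, hnorm, Complex.ofReal_one, one_smul]
  have := (hext _ (inv_norm_smul_mem_quasiStates hψ) _ (inv_norm_smul_mem_quasiStates hχ)
    ⟨_, _, hN ψ hψ0, hN _ hχ0, hadd.symm, by rw [hinv ψ hψ0, hinv _ hχ0, add_sub_cancel]⟩).1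
  conv_lhs => rw [← hinv ψ hψ0, this]
  rfl

/-- Pure states detect nonzero positive elements: an extreme point of the face of quasi-states
with maximal value at `h`. -/
theorem exists_isPureState_apply_ne_zero [PartialOrder A] [StarOrderedRing A]
    {h : A} (h0 : 0 ≤ h) (hne : h ≠ 0) : ∃ φ : WeakDual ℂ A, IsPureState φ ∧ φ h ≠ 0 := by
  obtain ⟨φ₀, hφ₀, hφ₀h⟩ := exists_isPositiveFunctional_apply_ne_zero h0 hne
  let L : StrongDual ℝ (WeakDual ℂ A) :=
    { toFun := fun φ => (φ h).re
      map_add' := fun φ ψ => Complex.add_re _ _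
      map_smul' := fun t φ => Complex.smul_re t (φ h)
      cont := Complex.continuous_re.comp (WeakDual.eval_continuous h) }
  have hpos : 0 < (φ₀ h).re :=
    (Complex.pos_iff.1 (lt_of_le_of_ne (hφ₀.apply_nonneg h0) hφ₀h.symm)).1
  have hφ₀N : 0 < ‖WeakDual.toStrongDual φ₀‖ := by
    refine norm_pos_iff.2 fun hz => hφ₀h ?_
    rw [(map_eq_zero_iff _ WeakDual.toStrongDual.injective).1 hz]; rfl
  have hmem := inv_norm_smul_mem_quasiStates hφ₀
  have hLpos : 0 < L (((‖WeakDual.toStrongDual φ₀‖⁻¹ : ℝ) : ℂ) • φ₀) := by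
    change 0 < (((‖WeakDual.toStrongDual φ₀‖⁻¹ : ℝ) : ℂ) * φ₀ h).re
    rw [Complex.re_ofReal_mul]; positivity
  have hexp : IsExposed ℝ (quasiStates A) (L.toExposed (quasiStates A)) :=
    ContinuousLinearMap.toExposed.isExposed
  have hK := isCompact_quasiStates (A := A)
  obtain ⟨m, hm, hmax⟩ := hK.exists_isMaxOn ⟨_, hmem⟩ L.continuous.continuousOn
  obtain ⟨φ, hφ⟩ := (hexp.isCompact hK).extremePoints_nonempty ⟨m, hm, fun y hy => hmax hy⟩
  have hφL : 0 < L φ := hLpos.trans_le (hφ.1.2 _ hmem)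
  refine ⟨φ, isPureState_of_mem_extremePoints
    (hexp.isExtreme.extremePoints_subset_extremePoints hφ) ?_, ?_⟩
  · rintro rfl
    exact hφL.ne' rfl
  · intro hz
    have : (φ h).re = 0 := by rw [hz]; rfl
    exact hφL.ne' this

end ExistencePure

/-! ### Tracial pure states -/

section Tracial

variable {A : Type u} [NonUnitalCStarAlgebra A]

theorem IsPureState.exists_apply_star_mul_self_ne_zero {φ : WeakDual ℂ A} (hφ : IsPureState φ) :
    ∃ x : A, φ (star x * x) ≠ 0 := by
  by_contra! h
  have h0 : WeakDual.toStrongDual φ = 0 := by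
    ext x
    have h1 := hφ.1.1.norm_apply_sq_le x
    rw [h x] at h1
    simpa using h1
  have := hφ.1.2
  rw [h0, norm_zero] at this
  exact zero_ne_one this

/-- A functional dominated by a multiple of a pure state is a multiple of it. -/
theorem IsPureState.exists_eq_smul_of_le {φ : WeakDual ℂ A} (hφ : IsPureState φ)
    {ψ : WeakDual ℂ A} (hψ : IsPositiveFunctional ψ) {c : ℝ} (hc : 0 ≤ c)
    (h : ∀ a : A, ψ (star a * a) ≤ (c : ℂ) * φ (star a * a)) : ∃ t : ℂ, ψ = t • φ := by
  have hc1 : 0 < c + 1 := by linarith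
  obtain ⟨t, -, -, ht⟩ := hφ.2 ((((c + 1)⁻¹ : ℝ) : ℂ) • ψ) (hψ.smul (by positivity)) fun a => by
    have h1 : ψ (star a * a) ≤ ((c + 1 : ℝ) : ℂ) * φ (star a * a) := by
      refine (h a).trans (mul_le_mul_of_nonneg_right ?_ (hφ.1.1 a))
      exact_mod_cast (lt_add_one c).le
    have h2 := mul_le_mul_of_nonneg_left h1
      (show (0 : ℂ) ≤ (((c + 1)⁻¹ : ℝ) : ℂ) by exact_mod_cast (inv_pos.2 hc1).le)
    rwa [← mul_assoc, ← Complex.ofReal_mul, inv_mul_cancel₀ hc1.ne', Complex.ofReal_one,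
      one_mul] at h2
  refine ⟨((c + 1 : ℝ) : ℂ) * t, ?_⟩
  rw [mul_smul, ← ht, smul_smul, ← Complex.ofReal_mul, mul_inv_cancel₀ hc1.ne',
    Complex.ofReal_one, one_smul]

/-- A pure state that is a trace is proportional to a character: for positive `b = a* a` the
functional `x ↦ φ (a x a*) = φ (b x)` is dominated by a multiple of `φ`, and such `b` span. -/
theorem IsPureState.exists_apply_mul_eq {φ : WeakDual ℂ A} (hφ : IsPureState φ)
    (htr : ∀ x y : A, φ (x * y) = φ (y * x)) (b : A) :
    ∃ t : ℂ, ∀ x : A, φ (b * x) = t * φ x := by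
  let _ : PartialOrder A := CStarAlgebra.spectralOrder A
  have _ : StarOrderedRing A := CStarAlgebra.spectralOrderedRing A
  have hb : b ∈ Submodule.span ℂ {x : A | 0 ≤ x} := by
    rw [CStarAlgebra.span_nonneg]; trivial
  induction hb using Submodule.span_induction with
  | zero => exact ⟨0, fun x => by simp⟩
  | add c d _ _ hc hd =>
    obtain ⟨s, hs⟩ := hc
    obtain ⟨t, ht⟩ := hd
    exact ⟨s + t, fun x => by rw [add_mul, map_add, hs, ht, add_mul]⟩
  | smul k c _ hc =>
    obtain ⟨s, hs⟩ := hc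
    exact ⟨k * s, fun x => by rw [smul_mul_assoc, map_smul, hs, smul_eq_mul, mul_assoc]⟩
  | mem c hc =>
    obtain ⟨a, rfl⟩ := CStarAlgebra.nonneg_iff_eq_star_mul_self.1 (Set.mem_ofPred_eq ▸ hc)
    let ψ : WeakDual ℂ A := StrongDual.toWeakDual
      ((WeakDual.toStrongDual φ).comp (ContinuousLinearMap.mul ℂ A (star a * a)))
    have hψ : ∀ x, ψ x = φ (star a * a * x) := fun x => rfl
    have hψ' : ∀ x, ψ (star x * x) = φ (star (a * star x) * (a * star x)) := fun x => by
      rw [hψ, mul_assoc, htr, htr (star (a * star x))]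
      simp only [star_mul, star_star, mul_assoc]
    have hle : ∀ x, ψ (star x * x) ≤ ((‖a‖ ^ 2 : ℝ) : ℂ) * φ (star x * x) := fun x => by
      have := hφ.1.1.apply_star_mul_self_mul_le (star x) a
      rwa [star_star, htr x, ← hψ'] at this
    obtain ⟨t, ht⟩ := hφ.exists_eq_smul_of_le (ψ := ψ)
      (fun x => by rw [hψ']; exact hφ.1.1 _) (by positivity) hle
    exact ⟨t, fun x => by rw [← hψ, ht]; rfl⟩

end Tracial

/-! ### Unitary orbits of pure states -/

section UnitaryOrbit

variable {A : Type u} [NonUnitalCStarAlgebra A]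

open Unitization

/-- The inner automorphism `x ↦ u* x u` of `A` given by a unitary `u` of the unitization. The
element `u* x u` has scalar part zero, so it is determined by its `A`-component. -/
noncomputable def unitaryConj (u : unitary (Unitization ℂ A)) : A →L[ℂ] A where
  toFun x := (star (u : Unitization ℂ A) * (x : Unitization ℂ A) * u).snd
  map_add' x y := by rw [inr_add, mul_add, add_mul, snd_add]
  map_smul' c x := by
    rw [inr_smul, mul_smul_comm, smul_mul_assoc, snd_smul, RingHom.id_apply]
  cont := Unitization.continuous_snd.comp
    ((continuous_const.mul Unitization.continuous_inr).mul continuous_const)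

theorem inr_unitaryConj (u : unitary (Unitization ℂ A)) (x : A) :
    (unitaryConj u x : Unitization ℂ A) = star (u : Unitization ℂ A) * x * u := by
  refine Unitization.ext ?_ rfl
  simp

theorem unitaryConj_mul (u : unitary (Unitization ℂ A)) (x y : A) :
    unitaryConj u (x * y) = unitaryConj u x * unitaryConj u y := by
  apply inr_injective (R := ℂ)
  simp only [inr_mul, inr_unitaryConj]
  have h : (u : Unitization ℂ A) * star (u : Unitization ℂ A) = 1 := Unitary.mul_star_self_of_mem u.2
  simp only [mul_assoc]
  rw [← mul_assoc (u : Unitization ℂ A), h, one_mul]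

theorem unitaryConj_star (u : unitary (Unitization ℂ A)) (x : A) :
    unitaryConj u (star x) = star (unitaryConj u x) := by
  apply inr_injective (R := ℂ)
  simp only [inr_star, inr_unitaryConj, star_mul, star_star, mul_assoc]

theorem unitaryConj_unitaryConj (u v : unitary (Unitization ℂ A)) (x : A) :
    unitaryConj v (unitaryConj u x) = unitaryConj (u * v) x := by
  apply inr_injective (R := ℂ)
  simp only [inr_unitaryConj, Submonoid.coe_mul, star_mul, mul_assoc]

theorem unitaryConj_one (x : A) : unitaryConj 1 x = x := by
  apply inr_injective (R := ℂ)
  simp [inr_unitaryConj]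

theorem norm_unitaryConj (u : unitary (Unitization ℂ A)) (x : A) : ‖unitaryConj u x‖ = ‖x‖ := by
  rw [← Unitization.norm_inr (𝕜 := ℂ), inr_unitaryConj, CStarRing.norm_mul_coe_unitary,
    ← Unitary.coe_star, CStarRing.norm_coe_unitary_mul, Unitization.norm_inr]

/-- The functional `x ↦ φ (u* x u)`. -/
noncomputable def unitaryTranslate (u : unitary (Unitization ℂ A)) (φ : WeakDual ℂ A) :
    WeakDual ℂ A :=
  StrongDual.toWeakDual ((WeakDual.toStrongDual φ).comp (unitaryConj u))

theorem unitaryTranslate_apply (u : unitary (Unitization ℂ A)) (φ : WeakDual ℂ A) (x : A) :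
    unitaryTranslate u φ x = φ (unitaryConj u x) := rfl

theorem unitaryTranslate_unitaryTranslate (u v : unitary (Unitization ℂ A)) (φ : WeakDual ℂ A) :
    unitaryTranslate u (unitaryTranslate v φ) = unitaryTranslate (u * v) φ :=
  DFunLike.ext _ _ fun x => by simp only [unitaryTranslate_apply, unitaryConj_unitaryConj]

theorem unitaryTranslate_one (φ : WeakDual ℂ A) : unitaryTranslate 1 φ = φ :=
  DFunLike.ext _ _ fun x => by rw [unitaryTranslate_apply, unitaryConj_one]

theorem unitaryTranslate_star_unitaryTranslate (u : unitary (Unitization ℂ A))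
    (φ : WeakDual ℂ A) : unitaryTranslate (star u) (unitaryTranslate u φ) = φ := by
  rw [unitaryTranslate_unitaryTranslate, Unitary.star_mul_self, unitaryTranslate_one]

theorem IsPositiveFunctional.comp_unitaryConj {φ : WeakDual ℂ A} (hφ : IsPositiveFunctional φ)
    (u : unitary (Unitization ℂ A)) : IsPositiveFunctional (unitaryTranslate u φ) := fun a => by
  rw [unitaryTranslate_apply, unitaryConj_mul, unitaryConj_star]
  exact hφ _

theorem norm_unitaryTranslate_le (u : unitary (Unitization ℂ A)) (φ : WeakDual ℂ A) :
    ‖WeakDual.toStrongDual (unitaryTranslate u φ)‖ ≤ ‖WeakDual.toStrongDual φ‖ :=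
  ContinuousLinearMap.opNorm_le_bound _ (norm_nonneg _) fun x => by
    have := norm_apply_le φ (unitaryConj u x)
    rwa [norm_unitaryConj] at this

theorem IsPureState.comp_unitaryConj {φ : WeakDual ℂ A} (hφ : IsPureState φ)
    (u : unitary (Unitization ℂ A)) : IsPureState (unitaryTranslate u φ) := by
  refine ⟨⟨hφ.1.1.comp_unitaryConj u, le_antisymm
    ((norm_unitaryTranslate_le u φ).trans_eq hφ.1.2) ?_⟩, fun ψ hψ hle => ?_⟩
  · have := norm_unitaryTranslate_le (star u) (unitaryTranslate u φ)
    rwa [unitaryTranslate_star_unitaryTranslate, hφ.1.2] at this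
  · obtain ⟨t, h0, h1, ht⟩ := hφ.2 (unitaryTranslate (star u) ψ)
      (hψ.comp_unitaryConj _) fun a => by
        have h := hle (unitaryConj (star u) a)
        rw [← unitaryConj_star, ← unitaryConj_mul, ← unitaryTranslate_apply,
          ← unitaryTranslate_apply, unitaryTranslate_star_unitaryTranslate] at h
        exact h
    refine ⟨t, h0, h1, ?_⟩
    have h2 := congrArg (unitaryTranslate u) ht
    rw [unitaryTranslate_unitaryTranslate, Unitary.mul_star_self, unitaryTranslate_one] at h2
    rw [h2]
    rfl

/-- If `φ` is invariant under the inner automorphisms given by `exp (i s h)` for small `s`, then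
differentiating at `s = 0` shows that `φ` vanishes on commutators with `h`. -/
theorem apply_mul_comm_of_eventually_eq {φ : WeakDual ℂ A} {h : A} (hh : IsSelfAdjoint h)
    (hφ : ∀ᶠ s : ℝ in 𝓝 0, unitaryTranslate (selfAdjoint.expUnitary
      (s • (⟨(h : Unitization ℂ A), hh.inr ℂ⟩ : selfAdjoint (Unitization ℂ A)))) φ = φ) (x : A) :
    φ (x * h) = φ (h * x) := by
  set k : Unitization ℂ A := Complex.I • (h : Unitization ℂ A) with hk
  have hu : ∀ s : ℝ, (selfAdjoint.expUnitary
      (s • (⟨(h : Unitization ℂ A), hh.inr ℂ⟩ : selfAdjoint (Unitization ℂ A))) :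
        Unitization ℂ A) = NormedSpace.exp (s • k) := fun s => by
    rw [selfAdjoint.expUnitary_coe, hk, smul_comm]
    rfl
  have hstar : ∀ s : ℝ, star (NormedSpace.exp (s • k)) = NormedSpace.exp (s • -k) := fun s => by
    rw [NormedSpace.star_exp, star_smul, hk, star_smul, (hh.inr ℂ).star_eq]
    simp
  let Φ : Unitization ℂ A →L[ℝ] ℂ :=
    { toFun := fun b => φ b.snd
      map_add' := fun b c => by rw [snd_add, map_add]
      map_smul' := fun t b => by
        rw [snd_smul, ← Complex.coe_smul, map_smul]; rfl
      cont := (WeakDual.toStrongDual φ).continuous.comp Unitization.continuous_snd }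
  have hd := ((hasDerivAt_exp_smul_const (𝕂 := ℝ) (-k) 0).mul_const (x : Unitization ℂ A)).mul
    (hasDerivAt_exp_smul_const (𝕂 := ℝ) k 0)
  have hd2 := Φ.hasFDerivAt.comp_hasDerivAt (0 : ℝ) hd
  have hd3 : HasDerivAt (fun _ : ℝ => φ x) 0 0 := hasDerivAt_const _ _
  have heq : (fun _ : ℝ => φ x) =ᶠ[𝓝 0] (Φ ∘ fun s : ℝ => NormedSpace.exp (s • -k) * x
      * NormedSpace.exp (s • k)) := by
    filter_upwards [hφ] with s hs
    have h1 := congrArg (fun ψ : WeakDual ℂ A => ψ x) hs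
    simp only [unitaryTranslate_apply] at h1
    rw [← h1]
    simp only [Function.comp_apply, ← hstar, ← hu]
    rfl
  have h0 := hd3.unique (hd2.congr_of_eventuallyEq heq)
  simp only [zero_smul, NormedSpace.exp_zero, one_mul, mul_one, hk] at h0
  have h1 : φ ((-(Complex.I • (h : Unitization ℂ A)) * (x : Unitization ℂ A)
    + (x : Unitization ℂ A) * (Complex.I • (h : Unitization ℂ A))).snd) = 0 := h0.symm
  rw [neg_mul, smul_mul_assoc, mul_smul_comm, ← inr_mul, ← inr_mul, ← inr_smul, ← inr_smul,
    ← inr_neg, ← inr_add, snd_inr, map_add, map_neg, map_smul, map_smul, smul_eq_mul,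
    smul_eq_mul, neg_add_eq_zero] at h1
  exact (mul_left_cancel₀ Complex.I_ne_zero h1).symm

/-- If the pure state space is scattered, every pure state is a trace: its orbit under the
unitaries of the unitization has an isolated point, which is fixed by all unitaries close to `1`,
and all points of the orbit are alike. -/
theorem IsPureState.apply_mul_comm_of_isScatteredSpace (hS : IsScatteredSpace (pureStates A))
    {φ : WeakDual ℂ A} (hφ : IsPureState φ) (x y : A) : φ (x * y) = φ (y * x) := by
  let orb : unitary (Unitization ℂ A) → pureStates A := fun u =>
    ⟨unitaryTranslate u φ, hφ.comp_unitaryConj u⟩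
  obtain ⟨_, ⟨v, rfl⟩, U, hU, hUS⟩ := hS (Set.range orb) (Set.range_nonempty _)
  set ψ := unitaryTranslate v φ with hψ
  have hsa : ∀ (h : A), IsSelfAdjoint h → ∀ a : A, ψ (a * h) = ψ (h * a) := fun h hh a => by
    refine apply_mul_comm_of_eventually_eq hh ?_ a
    let w : ℝ → unitary (Unitization ℂ A) := fun s => selfAdjoint.expUnitary
      (s • (⟨(h : Unitization ℂ A), hh.inr ℂ⟩ : selfAdjoint (Unitization ℂ A)))
    have hw : Continuous w := by fun_prop
    have hc : Continuous fun s => orb (w s * v) := by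
      refine Continuous.subtype_mk (WeakDual.continuous_of_continuous_eval fun a => ?_) _
      have hc' : Continuous fun s => ((w s * v : unitary (Unitization ℂ A)) : Unitization ℂ A) := by
        fun_prop
      have hca : Continuous fun s => unitaryConj (w s * v) a :=
        Unitization.continuous_snd.comp ((hc'.star.mul continuous_const).mul hc')
      exact (WeakDual.toStrongDual φ).continuous.comp hca
    have h0 : orb (w 0 * v) ∈ U := by
      have : orb v ∈ U ∩ Set.range orb := hUS ▸ rfl
      have hw0 : w 0 = 1 := by
        refine Subtype.ext ?_
        change NormedSpace.exp (Complex.I • ((0 : ℝ) • (h : Unitization ℂ A))) = 1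
        rw [zero_smul, smul_zero, NormedSpace.exp_zero]
      rw [hw0, one_mul]
      exact this.1
    filter_upwards [hc.continuousAt.eventually_mem (hU.mem_nhds h0)] with s hs
    have h1 : orb (w s * v) ∈ U ∩ Set.range orb := ⟨hs, Set.mem_range_self _⟩
    rw [hUS] at h1
    have h2 := congrArg Subtype.val h1
    change unitaryTranslate (w s) ψ = ψ
    rw [hψ, unitaryTranslate_unitaryTranslate]
    exact h2
  have htr : ∀ a b : A, ψ (a * b) = ψ (b * a) := fun a b => by
    rw [← realPart_add_I_smul_imaginaryPart b]
    simp only [mul_add, add_mul, map_add, mul_smul_comm, smul_mul_assoc, map_smul]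
    rw [hsa _ (realPart b).2, hsa _ (imaginaryPart b).2]
  have h := htr (unitaryConj (star v) x) (unitaryConj (star v) y)
  rwa [← unitaryConj_mul, ← unitaryConj_mul, ← unitaryTranslate_apply, ← unitaryTranslate_apply,
    hψ, unitaryTranslate_star_unitaryTranslate] at h

/-- If all pure states are traces, the algebra is commutative: a pure state, being proportional
to a character, vanishes at `z* z` for every commutator `z`. -/
theorem mul_comm_of_forall_isPureState
    (h : ∀ φ : WeakDual ℂ A, IsPureState φ → ∀ x y : A, φ (x * y) = φ (y * x)) (a b : A) :
    a * b = b * a := by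
  let _ : PartialOrder A := CStarAlgebra.spectralOrder A
  have _ : StarOrderedRing A := CStarAlgebra.spectralOrderedRing A
  by_contra hne
  obtain ⟨φ, hφ, hφz⟩ := exists_isPureState_apply_ne_zero
    (star_mul_self_nonneg (a * b - b * a))
    ((CStarRing.star_mul_self_ne_zero_iff _).2 (sub_ne_zero.2 hne))
  obtain ⟨t, ht⟩ := hφ.exists_apply_mul_eq (h φ hφ) (star (a * b - b * a))
  rw [ht, map_sub, h φ hφ a b, sub_self, mul_zero] at hφz
  exact hφz rfl

end UnitaryOrbit

/-! ### Pure states of a commutative scattered algebra -/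

section CommutativeScattered

variable {A : Type u} [NonUnitalCStarAlgebra A]

/-- Proportional pure states are equal: the factor is nonnegative and of modulus one. -/
theorem IsPureState.eq_of_eq_smul {φ ψ : WeakDual ℂ A} (hφ : IsPureState φ) (hψ : IsPureState ψ)
    {c : ℂ} (h : ∀ x, φ x = c * ψ x) : φ = ψ := by
  obtain ⟨x, hx⟩ := hψ.exists_apply_star_mul_self_ne_zero
  have hc0 : 0 ≤ c := by
    rw [← mul_div_cancel_right₀ c hx, ← h]
    exact div_nonneg (hφ.1.1 x) (hψ.1.1 x)
  have hcn : ‖c‖ = 1 := by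
    have h1 : φ = c • ψ := DFunLike.ext _ _ h
    have h2 := hφ.1.2
    rwa [h1, map_smul, norm_smul, hψ.1.2, mul_one] at h2
  have hc1 : c = 1 := by rw [Complex.eq_coe_norm_of_nonneg hc0, hcn, Complex.ofReal_one]
  exact DFunLike.ext _ _ fun y => by rw [h, hc1, one_mul]

/-- The closed ideal of the elements at which all functionals in `S` vanish, where `S` consists of
pure states of a commutative algebra. -/
def vanishingIdeal (hc : ∀ a b : A, a * b = b * a) (S : Set (pureStates A)) : ClosedIdeal A where
  carrier := {a | ∀ φ ∈ S, φ.1 a = 0}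
  add_mem' ha hb φ hφ := by rw [map_add, ha φ hφ, hb φ hφ, add_zero]
  zero_mem' φ _ := map_zero φ.1
  smul_mem' c a ha φ hφ := by rw [map_smul, ha φ hφ, smul_zero]
  mul_mem_left' a x hx φ hφ := by
    obtain ⟨t, ht⟩ := φ.2.exists_apply_mul_eq (fun x y => by rw [hc]) a
    rw [ht, hx φ hφ, mul_zero]
  mul_mem_right' {x} a hx φ hφ := by
    obtain ⟨t, ht⟩ := φ.2.exists_apply_mul_eq (fun x y => by rw [hc]) a
    rw [hc, ht, hx φ hφ, mul_zero]
  isClosed' := by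
    simp only [Set.ofPred_forall]
    exact isClosed_iInter fun φ => isClosed_iInter fun _ =>
      isClosed_singleton.preimage (WeakDual.toStrongDual φ.1).continuous

theorem mem_vanishingIdeal {hc : ∀ a b : A, a * b = b * a} {S : Set (pureStates A)} {a : A} :
    a ∈ (vanishingIdeal hc S).toSubmodule ↔ ∀ φ ∈ S, φ.1 a = 0 := Iff.rfl

/-- Let `e` lift a minimal projection of the quotient by the ideal of a set `S` of pure states.
A point `φ` of `S` with `φ e ≠ 0` satisfies `φ b = φ (e b e)`, which is a multiple of `φ e` whose
factor depends only on `b`; hence there is exactly one such point. -/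
theorem isScatteredSpace_of_isScatteredAlgebra (hc : ∀ a b : A, a * b = b * a)
    (hA : IsScatteredAlgebra A) : IsScatteredSpace (pureStates A) := by
  rintro S ⟨φ₀, hφ₀⟩
  set I := vanishingIdeal hc S with hI
  have hnt : Nontrivial I.Quot := by
    obtain ⟨x, hx⟩ := φ₀.2.exists_apply_star_mul_self_ne_zero
    refine nontrivial_of_ne (I.toSubmodule.mkQ (star x * x)) 0 fun h => hx ?_
    exact mem_vanishingIdeal.1 ((Submodule.Quotient.mk_eq_zero _).1 h) φ₀ hφ₀
  obtain ⟨p, hp0, hproj, hrange⟩ := hA I hnt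
  obtain ⟨e, rfl⟩ := I.toSubmodule.mkQ_surjective p
  have hidem : e * e - e ∈ I.toSubmodule := by
    have := hproj.isIdempotentElem.eq
    rw [← ClosedIdeal.mk_mul] at this
    exact (Submodule.Quotient.eq _).1 this
  have hmin : ∀ b : A, ∃ c : ℂ, e * b * e - c • e ∈ I.toSubmodule := fun b => by
    have : I.toSubmodule.mkQ e * I.toSubmodule.mkQ b * I.toSubmodule.mkQ e ∈
        Set.range (fun c : ℂ => c • I.toSubmodule.mkQ e) := hrange ▸ Set.mem_range_self _
    obtain ⟨c, hc⟩ := this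
    refine ⟨c, (Submodule.Quotient.eq _).1 ?_⟩
    rw [← ClosedIdeal.mk_mul, ← ClosedIdeal.mk_mul] at hc
    exact hc.symm
  choose c hcmin using hmin
  have key : ∀ φ ∈ S, φ.1 e ≠ 0 → ∀ b, φ.1 b = c b * φ.1 e := fun φ hφ he b => by
    obtain ⟨t, ht⟩ := φ.2.exists_apply_mul_eq (fun x y => by rw [hc]) e
    have h1 := mem_vanishingIdeal.1 hidem φ hφ
    rw [map_sub, ht, sub_eq_zero] at h1
    have ht1 : t = 1 := mul_right_cancel₀ he (h1.trans (one_mul _).symm)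
    have h2 := mem_vanishingIdeal.1 (hcmin b) φ hφ
    rwa [map_sub, map_smul, hc (e * b) e, ht, ht, ht1, one_mul, one_mul, sub_eq_zero] at h2
  have hex : ∃ φ ∈ S, φ.1 e ≠ 0 := by
    by_contra! h
    exact hp0 ((Submodule.Quotient.mk_eq_zero _).2 (mem_vanishingIdeal.2 h))
  obtain ⟨φ₁, hφ₁, hφ₁e⟩ := hex
  refine ⟨φ₁, hφ₁, {φ | φ.1 e ≠ 0}, ?_, ?_⟩
  · exact isOpen_ne.preimage ((WeakDual.eval_continuous e).comp continuous_subtype_val)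
  · refine Set.eq_singleton_iff_unique_mem.2 ⟨⟨hφ₁e, hφ₁⟩, fun φ ⟨he, hφ⟩ => ?_⟩
    refine Subtype.ext (φ.2.eq_of_eq_smul φ₁.2 (c := φ.1 e / φ₁.1 e) fun b => ?_)
    rw [key φ hφ he, key φ₁ hφ₁ hφ₁e b]
    field_simp

end CommutativeScattered

/-! ### Minimal projections from isolated characters -/

section Gelfand

variable {A : Type u}

/-- A nonzero character is a pure state: a positive functional dominated by it vanishes on its
kernel, by the Cauchy-Schwarz inequality. -/
theorem isPureState_of_map_mul [NonUnitalCStarAlgebra A] {φ : WeakDual ℂ A}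
    (hmul : ∀ a b, φ (a * b) = φ a * φ b) (hstar : ∀ a, φ (star a) = star (φ a))
    (hle : ∀ a, ‖φ a‖ ≤ ‖a‖) (hne : φ ≠ 0) : IsPureState φ := by
  have hss : ∀ a, φ (star a * a) = ((‖φ a‖ ^ 2 : ℝ) : ℂ) := fun a => by
    rw [hmul, hstar, ← starRingEnd_apply, Complex.conj_mul', Complex.ofReal_pow]
  have hpos : IsPositiveFunctional φ := fun a => by
    rw [hss]; exact Complex.zero_le_real.2 (sq_nonneg _)
  obtain ⟨x, hx⟩ := DFunLike.ne_iff.1 hne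
  have hx : φ x ≠ 0 := hx
  have hnorm : ‖WeakDual.toStrongDual φ‖ = 1 := by
    refine le_antisymm (ContinuousLinearMap.opNorm_le_bound _ zero_le_one fun a => by
      rw [one_mul]; exact hle a) ?_
    have h1 := hpos.norm_apply_sq_le x
    rw [hss, Complex.ofReal_re] at h1
    exact (le_mul_iff_one_le_left (by positivity)).1 h1
  refine ⟨⟨hpos, hnorm⟩, fun ψ hψ hψφ => ?_⟩
  have hker : ∀ a, φ a = 0 → ψ a = 0 := fun a ha => by
    have h1 := hψφ a
    rw [hss, ha, norm_zero, zero_pow two_ne_zero, Complex.ofReal_zero] at h1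
    have h2 := hψ.norm_apply_sq_le a
    rw [le_antisymm h1 (hψ a), Complex.zero_re, mul_zero] at h2
    exact norm_eq_zero.1 (pow_eq_zero_iff two_ne_zero |>.1 (le_antisymm h2 (sq_nonneg _)))
  have heq : ψ = (ψ x / φ x) • φ := DFunLike.ext _ _ fun a => by
    have h1 := hker (a - (φ a / φ x) • x) (by
      rw [map_sub, map_smul, smul_eq_mul, div_mul_cancel₀ _ hx, sub_self])
    rw [map_sub, map_smul, sub_eq_zero] at h1
    rw [h1]
    change φ a / φ x * ψ x = ψ x / φ x * φ a
    ring
  set c := ψ x / φ x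
  have hc : ∀ a, ψ a = c * φ a := fun a => by
    conv_lhs => rw [heq]
    rfl
  have hpx : 0 < φ (star x * x) := by
    rw [hss]; exact_mod_cast pow_pos (norm_pos_iff.2 hx) 2
  have hc0 : 0 ≤ c := by
    rw [← mul_div_cancel_right₀ c hpx.ne', ← hc]
    exact div_nonneg (hψ x) hpx.le
  have hcr := Complex.eq_coe_norm_of_nonneg hc0
  refine ⟨‖c‖, norm_nonneg _, ?_, by rw [← hcr]; exact heq⟩
  have h1 := hψφ x
  rw [hc, hcr, hss] at h1
  have h2 : ‖c‖ * ‖φ x‖ ^ 2 ≤ ‖φ x‖ ^ 2 := by exact_mod_cast h1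
  exact (mul_le_iff_le_one_left (pow_pos (norm_pos_iff.2 hx) 2)).1 h2

variable [NonUnitalCommCStarAlgebra A]

open WeakDual

/-- The restriction to `A` of a character of the unitization. -/
noncomputable def restrictCharacter (χ : characterSpace ℂ (Unitization ℂ A)) : WeakDual ℂ A :=
  StrongDual.toWeakDual
    { toFun := fun a => χ (a : Unitization ℂ A)
      map_add' := fun a b => by rw [Unitization.inr_add, map_add]
      map_smul' := fun c a => by rw [Unitization.inr_smul, map_smul, RingHom.id_apply]
      cont := (map_continuous χ).comp Unitization.continuous_inr }

theorem restrictCharacter_apply (χ : characterSpace ℂ (Unitization ℂ A)) (a : A) :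
    restrictCharacter χ a = χ (a : Unitization ℂ A) := rfl

theorem isPureState_restrictCharacter {χ : characterSpace ℂ (Unitization ℂ A)}
    (h : restrictCharacter χ ≠ 0) : IsPureState (restrictCharacter χ) := by
  refine isPureState_of_map_mul (fun a b => ?_) (fun a => ?_) (fun a => ?_) h
  · simp only [restrictCharacter_apply, Unitization.inr_mul, map_mul]
  · simp only [restrictCharacter_apply, Unitization.inr_star, map_star]
  · rw [restrictCharacter_apply, ← Unitization.norm_inr (𝕜 := ℂ) a]
    exact spectrum.norm_le_norm_of_mem (CharacterSpace.apply_mem_spectrum χ _)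

/-- Two characters of the unitization with the same restriction to `A` are equal. -/
theorem restrictCharacter_injective :
    Function.Injective (restrictCharacter : characterSpace ℂ (Unitization ℂ A) → WeakDual ℂ A) :=
  fun χ χ' h => CharacterSpace.ext fun b => by
    have h1 : ∀ a : A, χ (a : Unitization ℂ A) = χ' (a : Unitization ℂ A) := fun a =>
      DFunLike.congr_fun h a
    rw [← Unitization.inl_fst_add_inr_snd_eq b, map_add, map_add, h1,
      ← Unitization.algebraMap_eq_inl, AlgHomClass.commutes, AlgHomClass.commutes]

theorem continuous_restrictCharacter :
    Continuous (restrictCharacter : characterSpace ℂ (Unitization ℂ A) → WeakDual ℂ A) :=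
  WeakDual.continuous_of_continuous_eval fun a =>
    (WeakDual.eval_continuous (a : Unitization ℂ A)).comp continuous_subtype_val

/-- The Gelfand transforms of the elements of a closed ideal of `A`, as an ideal of the continuous
functions on the character space of the unitization. -/
noncomputable def gelfandIdeal (I : ClosedIdeal A) :
    Ideal C(characterSpace ℂ (Unitization ℂ A), ℂ) where
  carrier := (fun a : A => gelfandStarTransform (Unitization ℂ A) a) '' I.toSubmodule
  add_mem' := by
    rintro _ _ ⟨a, ha, rfl⟩ ⟨b, hb, rfl⟩
    exact ⟨a + b, I.toSubmodule.add_mem ha hb, by simp only [Unitization.inr_add, map_add]⟩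
  zero_mem' := ⟨0, I.toSubmodule.zero_mem, by simp only [Unitization.inr_zero, map_zero]⟩
  smul_mem' := by
    -- Every continuous function is the transform of some `b` in the unitization, and `b * a ∈ I`.
    rintro f _ ⟨a, ha, rfl⟩
    obtain ⟨b, rfl⟩ := (gelfandStarTransform (Unitization ℂ A)).surjective f
    refine ⟨b.fst • a + b.snd * a,
      I.toSubmodule.add_mem (I.toSubmodule.smul_mem _ ha) (I.mul_mem_left' _ ha), ?_⟩
    have h : ((b.fst • a + b.snd * a : A) : Unitization ℂ A) = b * a := by
      refine Unitization.ext ?_ ?_ <;> simp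
    exact (congrArg (gelfandStarTransform (Unitization ℂ A)) h).trans (map_mul _ _ _)

theorem isClosed_gelfandIdeal (I : ClosedIdeal A) :
    IsClosed (gelfandIdeal I : Set C(characterSpace ℂ (Unitization ℂ A), ℂ)) := by
  have h : Isometry (fun a : A => gelfandStarTransform (Unitization ℂ A) a) :=
    (gelfandTransform_isometry (Unitization ℂ A)).comp Unitization.isometry_inr
  exact h.isClosedEmbedding.isClosedMap _ I.isClosed'

/-- A closed ideal is determined by the characters that vanish on it. -/
theorem ClosedIdeal.mem_of_forall_character (I : ClosedIdeal A) {x : A}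
    (h : ∀ χ : characterSpace ℂ (Unitization ℂ A),
      (∀ y ∈ I.toSubmodule, restrictCharacter χ y = 0) → restrictCharacter χ x = 0) :
    x ∈ I.toSubmodule := by
  have hx : gelfandStarTransform (Unitization ℂ A) x ∈ gelfandIdeal I := by
    rw [← ContinuousMap.idealOfSet_ofIdeal_isClosed (isClosed_gelfandIdeal I),
      ContinuousMap.mem_idealOfSet]
    intro χ hχ
    rw [Set.mem_compl_iff, ContinuousMap.notMem_setOfIdeal] at hχ
    exact h χ fun y hy => hχ ⟨y, hy, rfl⟩
  obtain ⟨y, hy, hyx⟩ := hx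
  have := Unitization.inr_injective ((gelfandStarTransform (Unitization ℂ A)).injective hyx)
  exact this ▸ hy

/-- A relatively isolated point `χ₀` of the hull of a closed ideal `I` yields a minimal projection
of the quotient by `I`, namely the class of an element whose Gelfand transform is a Urysohn
function supported near `χ₀` and away from the character at infinity. -/
theorem isScatteredAlgebra_of_isScatteredSpace (hS : IsScatteredSpace (pureStates A)) :
    IsScatteredAlgebra A := by
  intro I hnt
  let S : Set (pureStates A) := {φ | ∃ χ : characterSpace ℂ (Unitization ℂ A),
    (∀ y ∈ I.toSubmodule, restrictCharacter χ y = 0) ∧ restrictCharacter χ = φ.1}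
  have hSne : S.Nonempty := by
    obtain ⟨q, hq⟩ := exists_ne (0 : I.Quot)
    obtain ⟨x, rfl⟩ := I.toSubmodule.mkQ_surjective q
    by_contra hemp
    refine hq ((Submodule.Quotient.mk_eq_zero _).2 (I.mem_of_forall_character fun χ hχ => ?_))
    by_contra hx
    have hp : IsPureState (restrictCharacter χ) := isPureState_restrictCharacter fun h0 => hx (by
      rw [h0]; rfl)
    exact hemp ⟨⟨_, hp⟩, χ, hχ, rfl⟩
  obtain ⟨⟨φ₀, hφ₀⟩, ⟨χ₀, hχ₀I, rfl⟩, U, hU, hUS⟩ := hS S hSne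
  obtain ⟨U', hU', rfl⟩ := isOpen_induced_iff.1 hU
  have hχ₀ : restrictCharacter χ₀ ∈ U' := by
    have : (⟨restrictCharacter χ₀, hφ₀⟩ : pureStates A) ∈ Subtype.val ⁻¹' U' ∩ S := hUS ▸ rfl
    exact this.1
  have hχ₀ne : restrictCharacter χ₀ ≠ 0 := fun h0 => by
    obtain ⟨x, hx⟩ := hφ₀.exists_apply_star_mul_self_ne_zero
    exact hx (by rw [h0]; rfl)
  let W : Set (characterSpace ℂ (Unitization ℂ A)) :=
    restrictCharacter ⁻¹' (U' ∩ {0}ᶜ)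
  have hW : IsOpen W := (hU'.inter isOpen_compl_singleton).preimage continuous_restrictCharacter
  have huniq : ∀ χ ∈ W, (∀ y ∈ I.toSubmodule, restrictCharacter χ y = 0) → χ = χ₀ :=
    fun χ hχ hχI => by
      have h1 : (⟨restrictCharacter χ, isPureState_restrictCharacter hχ.2⟩ : pureStates A) ∈
        Subtype.val ⁻¹' U' ∩ S := ⟨hχ.1, χ, hχI, rfl⟩
      rw [hUS] at h1
      exact restrictCharacter_injective (congrArg Subtype.val h1)
  obtain ⟨f, hf0, hf1, -⟩ := exists_continuous_zero_one_of_isClosed hW.isClosed_compl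
    (isClosed_singleton (x := χ₀)) (Set.disjoint_left.2 fun χ h1 h2 => h1 (by
      rw [Set.mem_singleton_iff.1 h2]; exact ⟨hχ₀, hχ₀ne⟩))
  let g : C(characterSpace ℂ (Unitization ℂ A), ℂ) :=
    ⟨fun χ => (f χ : ℂ), Complex.continuous_ofReal.comp f.continuous⟩
  obtain ⟨b, hb⟩ := (gelfandStarTransform (Unitization ℂ A)).surjective g
  have hbχ : ∀ χ : characterSpace ℂ (Unitization ℂ A), χ b = (f χ : ℂ) := fun χ =>
    DFunLike.congr_fun hb χ
  -- The character at infinity is not in `W`, so the scalar part of `b` is zero.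
  let χinf : characterSpace ℂ (Unitization ℂ A) :=
    CharacterSpace.equivAlgHom.symm (Unitization.fstHom ℂ A)
  have hinf : ∀ c : Unitization ℂ A, χinf c = c.fst := fun c => rfl
  have hbfst : b.fst = 0 := by
    rw [← hinf, hbχ, hf0 (show χinf ∈ Wᶜ from fun h => h.2 ?_)]
    · simp
    · exact DFunLike.ext _ _ fun a => by
        rw [restrictCharacter_apply, hinf, Unitization.fst_inr]; rfl
  have hbe : ((b.snd : A) : Unitization ℂ A) = b := by
    refine Unitization.ext ?_ rfl
    rw [Unitization.fst_inr, hbfst]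
  set e : A := b.snd
  have heχ : ∀ χ, restrictCharacter χ e = (f χ : ℂ) := fun χ => by
    rw [restrictCharacter_apply, hbe, hbχ]
  -- On the hull of `I` the function `f` is the indicator function of `χ₀`.
  have hmem : ∀ x : A, restrictCharacter χ₀ x = 0 →
      (∀ χ, f χ = 0 → restrictCharacter χ x = 0) → x ∈ I.toSubmodule := fun x h0 h1 =>
    I.mem_of_forall_character fun χ hχ => by
      by_cases hχW : χ ∈ W
      · rw [huniq χ hχW hχ, h0]
      · exact h1 χ (hf0 hχW)
  have hfχ₀ : f χ₀ = 1 := hf1 rfl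
  have hmul : ∀ (χ : characterSpace ℂ (Unitization ℂ A)) (x y : A), restrictCharacter χ (x * y)
      = restrictCharacter χ x * restrictCharacter χ y := fun χ x y => by
    simp only [restrictCharacter_apply, Unitization.inr_mul, map_mul]
  have hst : ∀ (χ : characterSpace ℂ (Unitization ℂ A)) (x : A), restrictCharacter χ (star x)
      = star (restrictCharacter χ x) := fun χ x => by
    simp only [restrictCharacter_apply, Unitization.inr_star, map_star]
  have hcorner : ∀ x : A, e * x * e - restrictCharacter χ₀ x • e ∈ I.toSubmodule := fun x => by
    refine hmem _ ?_ fun χ hχ => ?_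
    · rw [map_sub, map_smul, hmul, hmul, heχ, hfχ₀]; simp
    · rw [map_sub, map_smul, hmul, hmul, heχ, hχ]; simp
  refine ⟨I.toSubmodule.mkQ e, fun h => ?_, ⟨?_, ?_⟩, ?_⟩
  · have h1 := hχ₀I e ((Submodule.Quotient.mk_eq_zero _).1 h)
    rw [heχ, hfχ₀, Complex.ofReal_one] at h1
    exact one_ne_zero h1
  · change I.toSubmodule.mkQ (e * e) = I.toSubmodule.mkQ e
    refine (Submodule.Quotient.eq _).2 (hmem _ ?_ fun χ hχ => ?_)
    · rw [map_sub, hmul, heχ, hfχ₀]; simp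
    · rw [map_sub, hmul, heχ, hχ]; simp
  · change I.toSubmodule.mkQ (star e) = I.toSubmodule.mkQ e
    refine (Submodule.Quotient.eq _).2 (hmem _ ?_ fun χ hχ => ?_)
    · rw [map_sub, hst, heχ, hfχ₀]; simp
    · rw [map_sub, hst, heχ, hχ]; simp
  · refine Set.Subset.antisymm ?_ ?_
    · rintro _ ⟨q, rfl⟩
      obtain ⟨x, rfl⟩ := I.toSubmodule.mkQ_surjective q
      exact ⟨restrictCharacter χ₀ x, ((Submodule.Quotient.eq _).2 (hcorner x)).symm⟩
    · rintro _ ⟨c, rfl⟩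
      refine ⟨I.toSubmodule.mkQ (c • e), ?_⟩
      have h1 := hcorner (c • e)
      rw [map_smul, heχ, hfχ₀, Complex.ofReal_one, smul_eq_mul, mul_one] at h1
      exact (Submodule.Quotient.eq _).2 h1

end Gelfand

end CStar

/-! ### Scatteredness and the Cantor-Bendixson index -/

section CantorBendixsonIndex

open CantorBendixson

/-- The iterated derived sets stabilize, and a stable stage has no relatively isolated point;
conversely, a set without relatively isolated points is contained in every stage. -/
theorem isScatteredSpace_iff_exists_iteratedDerivedSet_eq_empty {T : Type u}
    [TopologicalSpace T] :
    IsScatteredSpace T ↔ ∃ α : Ordinal.{u}, (Set.univ : Set T)ᵈ[α] = ∅ := by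
  constructor
  · intro h
    obtain ⟨α, hα⟩ := iteratedDerivedSet_mem_fixedPoints (Set.univ : Set T)
    refine ⟨α, Set.not_nonempty_iff_eq_empty.1 fun hne => ?_⟩
    obtain ⟨x, hx, U, hU, hUx⟩ := h _ hne
    have hxU : x ∈ U := ((Set.ext_iff.1 hUx x).2 rfl).1
    have hacc : x ∈ relDerivedSet ((Set.univ : Set T)ᵈ[α]) := by
      rw [Function.mem_fixedPoints_iff.1 hα]; exact hx
    obtain ⟨y, hy, hyx⟩ := accPt_iff_nhds.1 hacc.1 U (hU.mem_nhds hxU)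
    exact hyx ((Set.ext_iff.1 hUx y).1 hy)
  · rintro ⟨α, hα⟩ S ⟨z, hz⟩
    by_contra! hS
    have hpre : Preperfect S := fun x hx => accPt_iff_nhds.2 fun V hV => by
      obtain ⟨U, hUV, hU, hxU⟩ := mem_nhds_iff.1 hV
      by_contra! hy
      exact hS x hx U hU (Set.eq_singleton_iff_unique_mem.2
        ⟨⟨hxU, hx⟩, fun y hyU => hy y ⟨hUV hyU.1, hyU.2⟩⟩)
    have hsub := iteratedDerivedSet_mono (Set.subset_univ S) α
    simp only [iteratedDerivedSet_constant_iff_preperfect.1 hpre α, hα] at hsub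
    exact hsub hz

theorem cantorBendixsonIndex_lt_top_iff {T : Type u} [TopologicalSpace T] :
    cantorBendixsonIndex T < ⊤ ↔ IsScatteredSpace T := by
  rw [isScatteredSpace_iff_exists_iteratedDerivedSet_eq_empty, cantorBendixsonIndex, sInf_lt_iff]
  constructor
  · rintro ⟨_, ⟨α, hα, rfl⟩, -⟩
    exact ⟨α, hα⟩
  · rintro ⟨α, hα⟩
    exact ⟨_, ⟨α, hα, rfl⟩, WithTop.coe_lt_top α⟩

end CantorBendixsonIndex

/-! ### The characterization -/

theorem CStar.isScatteredSpace_pureStates_iff (A : Type u) [NonUnitalCStarAlgebra A] :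
    IsScatteredSpace (CStar.pureStates A) ↔
      (∀ a b : A, a * b = b * a) ∧ CStar.IsScatteredAlgebra A := by
  refine ⟨fun h => ?_, fun h => isScatteredSpace_of_isScatteredAlgebra h.1 h.2⟩
  have hc : ∀ a b : A, a * b = b * a := mul_comm_of_forall_isPureState
    fun φ hφ x y => hφ.apply_mul_comm_of_isScatteredSpace h x y
  let _ : NonUnitalCommCStarAlgebra A := { ‹NonUnitalCStarAlgebra A› with mul_comm := hc }
  exact ⟨hc, isScatteredAlgebra_of_isScatteredSpace h⟩

theorem mainTheorem10 (A : Type u) [NonUnitalCStarAlgebra A] :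
    (cantorBendixsonIndex (CStar.pureStates A) < ⊤ ↔
      (∀ a b : A, a * b = b * a) ∧ CStar.IsScatteredAlgebra A) ∧
    (IsScatteredSpace (CStar.pureStates A) ↔
      (∀ a b : A, a * b = b * a) ∧ CStar.IsScatteredAlgebra A) :=
  ⟨cantorBendixsonIndex_lt_top_iff.trans (CStar.isScatteredSpace_pureStates_iff A),
    CStar.isScatteredSpace_pureStates_iff A⟩
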